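/- By a topos we mean an elementary topos: a category with finite limits and a subobject classifier that is cartesian closed. A geometric morphism $p:\mathcal{E}\to\mathcal{S}$ between toposes is an adjunction $p^*\dashv p_*:\mathcal{E}\to\mathcal{S}$ whose left adjoint $p^*$ (the inverse image functor) preserves finite limits; it is hyperconnected if $p^*$ is fully faithful and every component of the counit of $p^*\dashv p_*$ is monic. Let $\mathcal{E}$ be a topos, let $M$ be an object of $\mathcal{E}$, and let $\mu=(\mu_X:X\to M\mid X\in\mathcal{E})$ be a family of maps (not assumed natural). A map $f:X\to Y$ is non-singular with respect to $\mu$ if $\mu_X=\mu_Y f$. For an object $Y$, let $\mathcal{N}_\mu(Y)\subseteq\mathcal{E}/Y$ be the full subcategory of those maps into $Y$ that are non-singular with respect to $\mu$. If $(M,\wedge,\top)$ is a meet semilattice in $\mathcal{E}$ (an internal commutative monoid with idempotent multiplication), $\mu$ has the product property if $\mu_{X\times Y}=\wedge\circ(\mu_X\times\mu_Y):X\times Y\to M$ for all $X,Y$ in $\mathcal{E}$. A local state classifier in $\mathcal{E}$ is a colimit $(\xi_X:X\to\Xi\mid X\in\mathcal{E})$ of the inclusion $\mathcal{E}_m\to\mathcal{E}$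 of the subcategory of all objects and all monomorphisms of $\mathcal{E}$. Theorem. Let $\mathcal{E}$ be a topos. (1) Let $(M,\wedge,\top)$ be a meet semilattice in $\mathcal{E}$ and let $\mu=(\mu_X:X\to M\mid X\in\mathcal{E})$ be a family of maps that has the product property and with respect to which every monomorphism is non-singular. Then, for every object $Y$ of $\mathcal{E}$, the categories $\mathcal{E}/Y$ and $\mathcal{N}_\mu(Y)$ are toposes, and the inclusion $\mathcal{N}_\mu(Y)\to\mathcal{E}/Y$ is the inverse image functor of a hyperconnected geometric morphism $\mathcal{E}/Y\to\mathcal{N}_\mu(Y)$. (2) In particular this applies to every local state classifier $(\xi_X:X\to\Xi\mid X\in\mathcal{E})$ in $\mathcal{E}$: the object $\Xi$ carries a meet semilattice structure for which $\xi$ has the product property, monomorphisms are non-singular with respect to $\xi$, and hence, for every object $Y$ of $\mathcal{E}$, $\mathcal{N}_\xi(Y)$ is a topos and its inclusion into the topos $\mathcal{E}/Y$ is the inverse image functor of a hyperconnected geometric morphism $\mathcal{E}/Y\to\mathcal{N}_\xi(Y)$. -/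

import Mathlib

open CategoryTheory Limits MonoidalCategory CartesianMonoidalCategory

universe v u v' u'

/-- An (elementary) topos: a category with finite limits and a subobject classifier in which every
functor `X × -` has a right adjoint. -/
class IsElementaryTopos (E : Type u) [Category.{v} E] : Prop extends
    HasFiniteLimits E, HasSubobjectClassifier E where
  /-- Cartesian closedness. -/
  exponentiable : ∀ X : E, (prod.functor.obj X).IsLeftAdjoint

/-- A geometric morphism `E ⟶ S` between toposes: a direct image functor `E ⥤ S` with a left exact
left adjoint, the inverse image functor. -/
structure GeometricMorphism (E : Type u) [Category.{v} E] [IsElementaryTopos E]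
    (S : Type u') [Category.{v'} S] [IsElementaryTopos S] where
  /-- The direct image functor. -/
  direct : E ⥤ S
  /-- The inverse image functor. -/
  inverse : S ⥤ E
  /-- The inverse image functor is left adjoint to the direct image functor. -/
  adj : inverse ⊣ direct
  /-- The inverse image functor is left exact. -/
  preservesFiniteLimits : PreservesFiniteLimits inverse

/-- A geometric morphism is hyperconnected if it is connected, i.e. its inverse image functor is
fully faithful, and the counit of the adjunction is (pointwise) monic. -/
structure GeometricMorphism.IsHyperconnected {E : Type u} [Category.{v} E] [IsElementaryTopos E]
    {S : Type u'} [Category.{v'} S] [IsElementaryTopos S] (p : GeometricMorphism E S) : Prop where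
  full : p.inverse.Full
  faithful : p.inverse.Faithful
  mono_counit : ∀ X : E, Mono (p.adj.counit.app X)

/-- The functor `F` is the inverse image functor of a hyperconnected geometric morphism. -/
def IsHyperconnectedInverseImage {E : Type u} [Category.{v} E] [IsElementaryTopos E]
    {S : Type u'} [Category.{v'} S] [IsElementaryTopos S] (F : S ⥤ E) : Prop :=
  ∃ p : GeometricMorphism E S, p.inverse = F ∧ p.IsHyperconnected

/-- An internal meet semilattice `(M, ∧, ⊤)` in a category with (chosen) finite products: an
internal commutative monoid whose multiplication `∧` is idempotent. -/
class MeetSemilatticeObj {E : Type u} [Category.{v} E] [CartesianMonoidalCategory E]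
    [BraidedCategory E] (M : E) extends MonObj M, IsCommMonObj M where
  /-- `x ∧ x = x`. -/
  inf_idem : lift (𝟙 M) (𝟙 M) ≫ MonObj.mul = 𝟙 M

/-- A family `m X : X ⟶ M` has the product property if `m (X × Y) = ∧ ∘ (m X × m Y)`. -/
def HasProductProperty {E : Type u} [Category.{v} E] [CartesianMonoidalCategory E]
    [BraidedCategory E] {M : E} [MeetSemilatticeObj M] (m : ∀ X : E, X ⟶ M) : Prop :=
  ∀ X Y : E, m (X ⊗ Y) = (m X ⊗ₘ m Y) ≫ MonObj.mul

/-- A map `f : X ⟶ Y` is non-singular with respect to the family `m` if `m X = m Y ∘ f`. -/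
def IsNonSingular {E : Type u} [Category.{v} E] {M : E} (m : ∀ X : E, X ⟶ M)
    {X Y : E} (f : X ⟶ Y) : Prop :=
  m X = f ≫ m Y

/-- Every monomorphism is non-singular with respect to the family `m`. -/
def MonosNonSingular {E : Type u} [Category.{v} E] {M : E} (m : ∀ X : E, X ⟶ M) : Prop :=
  ∀ ⦃X Y : E⦄ (f : X ⟶ Y), Mono f → IsNonSingular m f

/-- The objects of `E/Y` whose structure map is non-singular with respect to `m`. -/
def nonSingularInto {E : Type u} [Category.{v} E] {M : E} (m : ∀ X : E, X ⟶ M) (Y : E) :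
    ObjectProperty (Over Y) :=
  fun f => IsNonSingular m f.hom

/-- The full subcategory of `E/Y` of the maps into `Y` that are non-singular with respect to `m`;
its inclusion into `E/Y` is `(nonSingularInto m Y).ι`. -/
abbrev NonSingularOver {E : Type u} [Category.{v} E] {M : E} (m : ∀ X : E, X ⟶ M) (Y : E) :=
  (nonSingularInto m Y).FullSubcategory

/-- A local state classifier in `E`: a colimit of the inclusion into `E` of the wide subcategory
of all objects and monomorphisms. -/
structure LocalStateClassifier (E : Type u) [Category.{v} E] where
  /-- The underlying cocone. -/
  cocone : Cocone (wideSubcategoryInclusion (MorphismProperty.monomorphisms E))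
  /-- The cocone is colimiting. -/
  isColimit : IsColimit cocone

namespace LocalStateClassifier

variable {E : Type u} [Category.{v} E]

/-- The vertex of the colimiting cocone. -/
def obj (L : LocalStateClassifier E) : E := L.cocone.pt

/-- The component at `X` of the colimiting cocone. -/
def leg (L : LocalStateClassifier E) (X : E) : X ⟶ L.obj := L.cocone.ι.app ⟨X⟩

end LocalStateClassifier

/-! The graph `(1, g) : Z → Z × X` is monic, so the product property gives `m Z = m Z ∧ m X g`, i.e.
`m Z ≤ m X g` for every `g`. If `f g` is non-singular, then `m Z ≤ m X g ≤ m Y f g = m Z`, so `g` is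
non-singular (`isNonSingular_of_comp`). Hence every map over `Y` from a non-singular object to `X`
factors through the equalizer of `m X` and `X → Y → M`, which is a monic coreflection of `X`.
Non-singular objects over `Y` are closed under subobjects and finite limits, and such a coreflective
subcategory of a topos is a topos, with classifier and exponentials obtained by coreflection
(`isHyperconnectedInverseImage_ι`).

This needs `E/Y` to be a topos. Its objects embed in power objects `Y × Ω^Z` by singletons, so
exponentials are needed only for these; there they split off `Y × Ω^(Z × A)`.

For a local state classifier, cartesian closedness makes products preserve the colimit, so `∧` is
induced by the legs at products; its laws hold because unitors, associators, symmetries and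
diagonals are monic. -/

section PartialRightAdjoint

/-! ### Pointwise existence of right adjoints -/

variable {C : Type u} [Category.{v} C] {D : Type u'} [Category.{v} D] (F : C ⥤ D)

/-- The right adjoint of `F` is defined at `X` if the presheaf `F.obj - ⟶ X` is a retract of a
representable one. -/
theorem rightAdjointObjIsDefined_of_retract [HasEqualizers C] {X : D} {B : C} (ε : F.obj B ⟶ X)
    (s : ∀ {W : C}, (F.obj W ⟶ X) → (W ⟶ B))
    (hs : ∀ {W W' : C} (f : W' ⟶ W) (p : F.obj W ⟶ X), s (F.map f ≫ p) = f ≫ s p)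
    (h : ∀ {W : C} (p : F.obj W ⟶ X), F.map (s p) ≫ ε = p) :
    F.rightAdjointObjIsDefined X := by
  -- `s ε` is the idempotent on `B` induced by the retraction; its splitting represents the retract.
  refine Functor.RepresentableBy.isRepresentable (Y := equalizer (s ε) (𝟙 B))
    { homEquiv := fun {W} =>
        { toFun := fun f => F.map (f ≫ equalizer.ι _ _) ≫ ε
          invFun := fun p => equalizer.lift (s p) (by rw [← hs, h, Category.comp_id])
          left_inv := fun f => by
            apply equalizer.hom_ext
            rw [equalizer.lift_ι, hs, Category.assoc, equalizer.condition, Category.comp_id]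
          right_inv := fun p => by
            dsimp only
            rw [equalizer.lift_ι, h] }
      homEquiv_comp := fun f g => by simp }

/-- A functor into a category in which monomorphisms are regular is a left adjoint as soon as every
object embeds in one at which the right adjoint is defined. -/
theorem isLeftAdjoint_of_exists_mono [HasEqualizers C] [IsRegularMonoCategory D]
    (h : ∀ Z : D, ∃ (X : D) (i : Z ⟶ X), Mono i ∧ F.rightAdjointObjIsDefined X) :
    F.IsLeftAdjoint := by
  refine Functor.isLeftAdjoint_of_rightAdjointObjIsDefined_eq_top (top_unique fun Z _ => ?_)
  obtain ⟨X, i, _, hX⟩ := h Z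
  have hi : RegularMono i := (IsRegularMonoCategory.regularMonoOfMono i).regularMono.some
  obtain ⟨T, j, _, hT⟩ := h hi.Z
  have w : i ≫ hi.left ≫ j = i ≫ hi.right ≫ j := by
    rw [← Category.assoc, hi.w, Category.assoc]
  -- `Z` is an equalizer of maps `X ⇉ T` between objects where the right adjoint is defined, and
  -- such objects are closed under limits.
  have hlim : IsLimit (Fork.ofι i w) := isEqualizerCompMono hi.isLimit j
  refine F.rightAdjointObjIsDefined_of_isLimit hlim ?_
  rintro (_ | _)
  exacts [hX, hT]

end PartialRightAdjoint

/-! ### Subobject classifiers in slices -/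

section Slice

variable {E : Type u} [Category.{v} E] [CartesianMonoidalCategory E]

/-- The product projection `Y ⊗ T ⟶ Y`, as an object over `Y`. -/
abbrev overFst (Y T : E) : Over Y := Over.mk (fst Y T)

/-- The map over `Y` into `Y ⊗ T` with second component `t`. -/
abbrev toOverFst {Y T : E} {X : Over Y} (t : X.left ⟶ T) : X ⟶ overFst Y T :=
  Over.homMk (lift X.hom t)

theorem overFst_hom_ext {Y T : E} {X : Over Y} {f g : X ⟶ overFst Y T}
    (h : f.left ≫ snd Y T = g.left ≫ snd Y T) : f = g := by
  ext
  apply CartesianMonoidalCategory.hom_ext _ _ _ h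
  exact (Over.w f).trans (Over.w g).symm

theorem isPullback_whiskerLeft_snd (Y : E) {S T : E} (t : S ⟶ T) :
    IsPullback (Y ◁ t) (snd Y S) (snd Y T) t where
  w := by simp
  isLimit' := ⟨PullbackCone.IsLimit.mk _ (fun c => lift (c.fst ≫ fst _ _) c.snd)
    (fun c => by ext <;> simp [c.condition]) (fun c => by simp)
    (fun c m h₁ h₂ => by ext <;> simp [← h₁, ← h₂])⟩

/-- `Y ◁ t` is a pullback of `t`, so pasting reduces classification in the slice to classification
in `E`. -/
theorem isPullback_over_iff [HasPullbacks E] {Y S T : E} (t : S ⟶ T) {U X : Over Y} (m : U ⟶ X)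
    (a : U ⟶ overFst Y S) (b : X ⟶ overFst Y T) :
    IsPullback m a b (Over.homMk (Y ◁ t) : overFst Y S ⟶ overFst Y T) ↔
      IsPullback m.left (a.left ≫ snd Y S) (b.left ≫ snd Y T) t := by
  refine ⟨fun h => (h.map (Over.forget Y)).paste_vert (isPullback_whiskerLeft_snd Y t), fun h => ?_⟩
  have w : m ≫ b = a ≫ (Over.homMk (Y ◁ t) : overFst Y S ⟶ overFst Y T) :=
    overFst_hom_ext (by simpa using h.w)
  exact IsPullback.of_map (Over.forget Y) w
    (IsPullback.of_bot h congr(($w).left) (isPullback_whiskerLeft_snd Y t))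

/-- The slices of a category with finite limits and a subobject classifier have one too. -/
theorem hasSubobjectClassifier_over [HasPullbacks E] [HasSubobjectClassifier E] (Y : E) :
    HasSubobjectClassifier (Over Y) := by
  obtain ⟨⟨c⟩⟩ := ‹HasSubobjectClassifier E›
  refine ⟨⟨{
    Ω₀ := overFst Y c.Ω₀
    Ω := overFst Y c.Ω
    truth := Over.homMk (Y ◁ c.truth)
    mono_truth := ?_
    χ₀ := fun U => toOverFst (c.χ₀ U.left)
    χ := fun m _ => toOverFst (c.χ m.left)
    isPullback := fun m _ => (isPullback_over_iff _ _ _ _).2 (by simpa using c.isPullback m.left)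
    uniq := fun m _ χ₀' χ' h => overFst_hom_ext (by
      simpa using c.uniq m.left ((isPullback_over_iff _ _ _ _).1 h)) }⟩⟩
  refine ⟨fun f g h => overFst_hom_ext ?_⟩
  rw [← cancel_mono c.truth]
  simpa using congr(($h).left ≫ snd _ _)

end Slice

theorem isPullback_of_exists_lift {E : Type u} [Category.{v} E] {A B C D : E} {f : A ⟶ B}
    {g : A ⟶ C} {h : B ⟶ D} {i : C ⟶ D} (w : f ≫ h = g ≫ i)
    (hl : ∀ ⦃T : E⦄ (b : T ⟶ B) (c : T ⟶ C), b ≫ h = c ≫ i → ∃ l : T ⟶ A, l ≫ f = b ∧ l ≫ g = c)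
    (hu : ∀ ⦃T : E⦄ (l l' : T ⟶ A), l ≫ f = l' ≫ f → l ≫ g = l' ≫ g → l = l') :
    IsPullback f g h i := by
  choose l hl₁ hl₂ using hl
  exact ⟨⟨w⟩, ⟨PullbackCone.IsLimit.mk _ (fun s => l _ _ s.condition) (fun s => hl₁ _ _ _)
    (fun s => hl₂ _ _ _) fun s m h₁ h₂ => hu _ _ (h₁.trans (hl₁ _ _ _).symm)
      (h₂.trans (hl₂ _ _ _).symm)⟩⟩

/-! ### Direct images of predicates along monomorphisms -/

section Classifier

variable {E : Type u} [Category.{v} E] (c : Subobject.Classifier E)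

theorem comp_classifier_χ {U X U' X' : E} {m : U ⟶ X} [Mono m] {m' : U' ⟶ X'} [Mono m']
    {f : X' ⟶ X} {f' : U' ⟶ U} (h : IsPullback m' f' f m) : f ≫ c.χ m = c.χ m' :=
  c.uniq m' (h.paste_vert (c.isPullback m))

theorem classifier_χ_congr {U U' X : E} {m : U ⟶ X} [Mono m] {m' : U' ⟶ X} [Mono m'] (e : U' ≅ U)
    (h : e.hom ≫ m = m') : c.χ m = c.χ m' := by
  rw [← comp_classifier_χ c (f := 𝟙 X) (f' := e.hom)
    (IsPullback.of_vert_isIso ⟨by rw [Category.comp_id, h]⟩), Category.id_comp]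

variable [HasPullbacks E]

/-- The direct image of predicates along a monomorphism. -/
noncomputable def existsAlong {U X : E} (i : U ⟶ X) [Mono i] (φ : U ⟶ c.Ω) : X ⟶ c.Ω :=
  c.χ (pullback.fst φ c.truth ≫ i)

theorem existsAlong_χ {U X V : E} (i : U ⟶ X) [Mono i] (m : V ⟶ U) [Mono m] :
    existsAlong c i (c.χ m) = c.χ (m ≫ i) :=
  classifier_χ_congr c (c.isPullback m).isoPullback (by simp)

/-- Since `i` is monic, pulling `V → U → X` back along `i` returns `V`. Thus direct image is a
section of restriction. -/
theorem comp_existsAlong_self {U X : E} (i : U ⟶ X) [Mono i] (φ : U ⟶ c.Ω) :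
    i ≫ existsAlong c i φ = φ := by
  obtain ⟨V, m, _, rfl⟩ := c.surjective_χ φ
  rw [existsAlong_χ]
  refine comp_classifier_χ c (f' := 𝟙 V) (isPullback_of_exists_lift (by simp)
    (fun T a b h => ⟨b, ?_, Category.comp_id b⟩) (fun T l l' _ h => by simpa using h))
  rw [← cancel_mono i, h, Category.assoc]

/-- The Beck–Chevalley condition, by pasting pullbacks; it makes `powerTranspose` natural. -/
theorem comp_existsAlong {U X U' X' : E} {i : U ⟶ X} [Mono i] {i' : U' ⟶ X'} [Mono i']
    {f : X' ⟶ X} {f' : U' ⟶ U} (h : IsPullback i' f' f i) (φ : U ⟶ c.Ω) :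
    f ≫ existsAlong c i φ = existsAlong c i' (f' ≫ φ) := by
  obtain ⟨V, m, _, rfl⟩ := c.surjective_χ φ
  have hm := IsPullback.of_hasPullback f' m
  rw [existsAlong_χ, comp_classifier_χ c hm, existsAlong_χ]
  exact comp_classifier_χ c (hm.paste_horiz h)

end Classifier

/-! ### Singletons and products -/

section Singleton

variable {E : Type u} [Category.{v} E] [CartesianMonoidalCategory E] (c : Subobject.Classifier E)

/-- The singleton map from an object into its power object. -/
noncomputable def singletonMap (Z : E) [Closed Z] : Z ⟶ (ihom Z).obj c.Ω :=
  MonoidalClosed.curry (c.χ (lift (𝟙 Z) (𝟙 Z)))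

instance mono_singletonMap (Z : E) [Closed Z] : Mono (singletonMap c Z) where
  right_cancellation {T} f g h := by
    have hδ : Z ◁ f ≫ c.χ (lift (𝟙 Z) (𝟙 Z)) = Z ◁ g ≫ c.χ (lift (𝟙 Z) (𝟙 Z)) := by
      apply MonoidalClosed.curry_injective
      simpa only [MonoidalClosed.curry_natural_left, singletonMap] using h
    -- Equal singletons give `δ(f, g) = δ(f, f)`, which is true, so `(f, g)` factors through the
    -- diagonal.
    have h₁ : lift f g ≫ c.χ (lift (𝟙 Z) (𝟙 Z)) = (f ≫ c.χ₀ Z) ≫ c.truth := by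
      have := congr(lift f (𝟙 T) ≫ $hδ)
      simp only [lift_whiskerLeft_assoc, Category.id_comp] at this
      rw [← this, Category.assoc, ← (c.isPullback (lift (𝟙 Z) (𝟙 Z))).w, comp_lift_assoc,
        Category.comp_id]
    have h₂ := (c.isPullback (lift (𝟙 Z) (𝟙 Z))).lift_fst _ _ h₁
    rw [comp_lift, Category.comp_id] at h₂
    have h₃ := congr($h₂ ≫ fst _ _)
    have h₄ := congr($h₂ ≫ snd _ _)
    simp only [lift_fst, lift_snd] at h₃ h₄
    exact h₃.symm.trans h₄

end Singleton

section WhiskerLeft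

variable {E : Type u} [Category.{v} E] [CartesianMonoidalCategory E]

theorem isPullback_whiskerLeft (Z : E) {A B C D : E} {f : A ⟶ B} {g : A ⟶ C} {h : B ⟶ D}
    {i : C ⟶ D} (sq : IsPullback f g h i) : IsPullback (Z ◁ f) (Z ◁ g) (Z ◁ h) (Z ◁ i) := by
  refine isPullback_of_exists_lift (by simp [← MonoidalCategory.whiskerLeft_comp, sq.w])
    (fun T b c hbc => ?_) fun T l l' h₁ h₂ => ?_
  · have h₁ := congr($hbc ≫ fst _ _)
    have h₂ := congr($hbc ≫ snd _ _)
    simp only [Category.assoc, whiskerLeft_fst, whiskerLeft_snd] at h₁ h₂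
    refine ⟨lift (b ≫ fst _ _) (sq.lift (b ≫ snd _ _) (c ≫ snd _ _) (by simpa using h₂)), ?_, ?_⟩
    · ext <;> simp
    · ext <;> simp [h₁]
  · ext
    · simpa using congr($h₁ ≫ fst _ _)
    · apply sq.hom_ext
      · simpa using congr($h₁ ≫ snd _ _)
      · simpa using congr($h₂ ≫ snd _ _)

instance mono_whiskerLeft (Z : E) {A B : E} (f : A ⟶ B) [Mono f] : Mono (Z ◁ f) where
  right_cancellation a b h := by
    have h₁ := congr($h ≫ fst _ _)
    have h₂ := congr($h ≫ snd _ _)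
    simp only [Category.assoc, whiskerLeft_fst, whiskerLeft_snd] at h₁ h₂
    ext
    · exact h₁
    · rw [← cancel_mono f]
      simpa using h₂

end WhiskerLeft

/-! ### Cartesian closedness of slices -/

section SliceClosed

variable {E : Type u} [Category.{v} E] [HasFiniteLimits E] {Y : E}

/-- The map into the fibre product over `Y` induced by two maps that agree over `Y`. -/
noncomputable def overProdLift {A W : Over Y} {T : E} (a : T ⟶ A.left) (w : T ⟶ W.left)
    (h : a ≫ A.hom = w ≫ W.hom) : T ⟶ (A ⨯ W).left :=
  (prod.lift (Over.homMk a : Over.mk (a ≫ A.hom) ⟶ A) (Over.homMk w h.symm)).left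

theorem overProdLift_fst {A W : Over Y} {T : E} (a : T ⟶ A.left) (w : T ⟶ W.left)
    (h : a ≫ A.hom = w ≫ W.hom) :
    overProdLift a w h ≫ (prod.fst : A ⨯ W ⟶ A).left = a :=
  congr($(prod.lift_fst (Over.homMk a : Over.mk (a ≫ A.hom) ⟶ A) (Over.homMk w h.symm)).left)

theorem overProdLift_snd {A W : Over Y} {T : E} (a : T ⟶ A.left) (w : T ⟶ W.left)
    (h : a ≫ A.hom = w ≫ W.hom) :
    overProdLift a w h ≫ (prod.snd : A ⨯ W ⟶ W).left = w :=
  congr($(prod.lift_snd (Over.homMk a : Over.mk (a ≫ A.hom) ⟶ A) (Over.homMk w h.symm)).left)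

theorem overProd_hom_ext {A W : Over Y} {T : E} {f g : T ⟶ (A ⨯ W).left}
    (h₁ : f ≫ (prod.fst : A ⨯ W ⟶ A).left = g ≫ (prod.fst : A ⨯ W ⟶ A).left)
    (h₂ : f ≫ (prod.snd : A ⨯ W ⟶ W).left = g ≫ (prod.snd : A ⨯ W ⟶ W).left) : f = g := by
  have h : g ≫ (A ⨯ W).hom = f ≫ (A ⨯ W).hom := by
    rw [← Over.w (prod.fst : A ⨯ W ⟶ A), reassoc_of% h₁]
  let f' : Over.mk (f ≫ (A ⨯ W).hom) ⟶ A ⨯ W := Over.homMk f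
  let g' : Over.mk (f ≫ (A ⨯ W).hom) ⟶ A ⨯ W := Over.homMk g h
  have : f' = g' := Limits.prod.hom_ext (by ext; exact h₁) (by ext; exact h₂)
  exact congr(($this).left)

variable [CartesianMonoidalCategory E]

/-- The inclusion of the fibre product over `Y` in the product. -/
noncomputable abbrev overProdToTensor (A W : Over Y) : (A ⨯ W).left ⟶ A.left ⊗ W.left :=
  lift (prod.fst : A ⨯ W ⟶ A).left (prod.snd : A ⨯ W ⟶ W).left

instance mono_overProdToTensor (A W : Over Y) : Mono (overProdToTensor A W) where
  right_cancellation f g h := overProd_hom_ext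
    (by simpa using congr($h ≫ fst _ _)) (by simpa using congr($h ≫ snd _ _))

theorem overProdToTensor_natural (A : Over Y) {W' W : Over Y} (f : W' ⟶ W) :
    (prod.map (𝟙 A) f).left ≫ overProdToTensor A W = overProdToTensor A W' ≫ A.left ◁ f.left := by
  ext <;> simp [← Over.comp_left]

/-- As `f` lies over `Y`, a pair in `A × W'` agrees over `Y` exactly when its image in `A × W` does.
-/
theorem isPullback_overProdToTensor (A : Over Y) {W' W : Over Y} (f : W' ⟶ W) :
    IsPullback (overProdToTensor A W') (prod.map (𝟙 A) f).left (A.left ◁ f.left)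
      (overProdToTensor A W) := by
  refine isPullback_of_exists_lift (overProdToTensor_natural A f).symm (fun T b c h => ?_)
    fun T l l' h _ => by rwa [cancel_mono] at h
  have h₁ := congr($h ≫ fst _ _)
  have h₂ := congr($h ≫ snd _ _)
  simp only [Category.assoc, whiskerLeft_fst, whiskerLeft_snd, lift_fst, lift_snd] at h₁ h₂
  have hY : (b ≫ fst _ _) ≫ A.hom = (b ≫ snd _ _) ≫ W'.hom := by
    rw [h₁, Category.assoc, Over.w, ← Over.w f, Category.assoc, reassoc_of% h₂, Over.w]
  have hl : overProdLift _ _ hY ≫ overProdToTensor A W' = b := by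
    ext <;> simp [overProdLift_fst _ _ hY, overProdLift_snd _ _ hY]
  refine ⟨overProdLift _ _ hY, hl, ?_⟩
  rw [← cancel_mono (overProdToTensor A W), Category.assoc, overProdToTensor_natural,
    reassoc_of% hl, h]

variable [MonoidalClosed E] (c : Subobject.Classifier E)

/-- The transpose over `Y` of a family of subobjects parametrized by a fibre product. -/
noncomputable def powerTranspose {A W : Over Y} {Z : E} (q : (A ⨯ W).left ⟶ (ihom Z).obj c.Ω) :
    W.left ⟶ (ihom (Z ⊗ A.left)).obj c.Ω :=
  MonoidalClosed.curry ((α_ _ _ _).hom ≫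
    existsAlong c (Z ◁ overProdToTensor A W) (MonoidalClosed.uncurry q))

/-- The family of subobjects parametrized by a fibre product that is obtained by restriction of one
parametrized by the product. -/
noncomputable def powerEval {A W : Over Y} {Z : E} (b : W.left ⟶ (ihom (Z ⊗ A.left)).obj c.Ω) :
    (A ⨯ W).left ⟶ (ihom Z).obj c.Ω :=
  MonoidalClosed.curry (Z ◁ overProdToTensor A W ≫ (α_ _ _ _).inv ≫ MonoidalClosed.uncurry b)

theorem powerEval_powerTranspose {A W : Over Y} {Z : E} (q : (A ⨯ W).left ⟶ (ihom Z).obj c.Ω) :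
    powerEval c (powerTranspose c q) = q := by
  rw [powerEval, powerTranspose, MonoidalClosed.uncurry_curry, Iso.inv_hom_id_assoc,
    comp_existsAlong_self, MonoidalClosed.curry_uncurry]

theorem powerTranspose_natural {A W W' : Over Y} (f : W' ⟶ W) {Z : E}
    (q : (A ⨯ W).left ⟶ (ihom Z).obj c.Ω) :
    powerTranspose c ((prod.map (𝟙 A) f).left ≫ q) = f.left ≫ powerTranspose c q := by
  rw [powerTranspose, powerTranspose, ← MonoidalClosed.curry_natural_left,
    MonoidalClosed.uncurry_natural_left,
    ← comp_existsAlong c (isPullback_whiskerLeft Z (isPullback_overProdToTensor A f)),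
    ← associator_naturality_right_assoc]

theorem powerEval_natural {A W W' : Over Y} (f : W' ⟶ W) {Z : E}
    (b : W.left ⟶ (ihom (Z ⊗ A.left)).obj c.Ω) :
    (prod.map (𝟙 A) f).left ≫ powerEval c b = powerEval c (f.left ≫ b) := by
  rw [powerEval, powerEval, ← MonoidalClosed.curry_natural_left,
    MonoidalClosed.uncurry_natural_left, ← MonoidalCategory.whiskerLeft_comp_assoc,
    overProdToTensor_natural, MonoidalCategory.whiskerLeft_comp_assoc,
    associator_inv_naturality_right_assoc]

/-- Relations on `Z × (A ×_Y W)` are a retract, natural in `W`, of those on `(Z × A) × W`, by direct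
image and restriction; the latter are represented over `Y` by `Y × Ω^(Z × A)`. -/
theorem rightAdjointObjIsDefined_powerObject (A : Over Y) (Z : E) :
    (prod.functor.obj A).rightAdjointObjIsDefined (overFst Y ((ihom Z).obj c.Ω)) := by
  have hs {W : Over Y} (q : (A ⨯ W).left ⟶ (ihom Z).obj c.Ω) :
      (toOverFst (powerTranspose c q)).left ≫ snd Y _ = powerTranspose c q := lift_snd _ _
  refine rightAdjointObjIsDefined_of_retract (B := overFst Y ((ihom (Z ⊗ A.left)).obj c.Ω)) _
    (toOverFst (powerEval c (snd _ _)))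
    (fun {W} p => toOverFst (powerTranspose c (A := A) (p.left ≫ snd _ _))) (fun {W W'} f p => ?_)
    fun {W} p => ?_
  · refine overFst_hom_ext ((hs _).trans (Eq.trans ?_ (Category.assoc _ _ _).symm))
    rw [hs, ← powerTranspose_natural]
    exact congr(powerTranspose c $(Category.assoc _ _ _))
  · refine overFst_hom_ext ((Category.assoc _ _ _).trans ((congr(_ ≫ $(lift_snd _ _))).trans
      ((powerEval_natural c _ _).trans ?_)))
    rw [hs]
    exact powerEval_powerTranspose c _

end SliceClosed

/-- Elementary toposes are cartesian closed, whatever the choice of finite products. -/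
@[reducible]
noncomputable def monoidalClosedOfIsElementaryTopos (E : Type u) [Category.{v} E]
    [IsElementaryTopos E] [CartesianMonoidalCategory E] : MonoidalClosed E where
  closed X :=
    have : (tensorLeft X).IsLeftAdjoint :=
      have := IsElementaryTopos.exponentiable X
      Functor.isLeftAdjoint_of_iso (CartesianMonoidalCategory.tensorLeftIsoProd X).symm
    { rightAdj := _, adj := Adjunction.ofIsLeftAdjoint _ }

/-- The slices of an elementary topos are elementary toposes. -/
theorem isElementaryTopos_over {E : Type u} [Category.{v} E] [IsElementaryTopos E]
    [CartesianMonoidalCategory E] (Y : E) : IsElementaryTopos (Over Y) := by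
  let := monoidalClosedOfIsElementaryTopos E
  have := hasSubobjectClassifier_over Y
  refine { exponentiable := fun A => isLeftAdjoint_of_exists_mono _ fun Z => ?_ }
  let c := (HasSubobjectClassifier.exists_classifier (C := E)).some
  refine ⟨_, toOverFst (singletonMap c Z.left), ?_, rightAdjointObjIsDefined_powerObject c A Z.left⟩
  have : Mono (lift Z.hom (singletonMap c Z.left)) := by
    have : Mono (lift Z.hom (singletonMap c Z.left) ≫ snd _ _) := by
      rw [lift_snd]; infer_instance
    exact mono_of_mono _ (snd _ _)
  exact Over.mono_of_mono_left _

/-! ### Closure under finite limits and monic coreflections -/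

section Coreflective

variable {C : Type u} [Category.{v} C] {P : ObjectProperty C}

/-- A limit embeds in the product of the objects of its diagram. -/
theorem isClosedUnderLimitsOfShape_of_mono [HasFiniteProducts C] (hT : P (⊤_ C))
    (hP : ∀ X Y, P X → P Y → P (X ⨯ Y)) (hM : ∀ ⦃X Y : C⦄ (i : X ⟶ Y), Mono i → P Y → P X)
    (J : Type) [SmallCategory J] [FinCategory J] : P.IsClosedUnderLimitsOfShape J where
  limitsOfShape_le := by
    have : P.IsClosedUnderIsomorphisms := ⟨fun e => hM e.inv inferInstance⟩
    have : P.IsClosedUnderLimitsOfShape (Discrete.{0} PEmpty) := .mk' (by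
      rintro _ ⟨F, hF⟩
      exact hM (terminal.from _) ⟨fun a b _ => limit.hom_ext fun j => j.as.elim⟩ hT)
    have : P.IsClosedUnderBinaryProducts := .mk' (by
      rintro _ ⟨F, hF⟩
      exact P.prop_of_iso (HasLimit.isoOfNatIso (diagramIsoPair F)).symm (hP _ _ (hF _) (hF _)))
    have : P.IsClosedUnderFiniteProducts := .mk'
    rintro X ⟨h⟩
    refine hM (Pi.lift fun j => h.π.app j) ⟨fun a b hab => h.isLimit.hom_ext fun j => ?_⟩
      (P.prop_pi h.diag.obj h.prop_diag_obj)
    simpa using congr($hab ≫ Pi.π _ j)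

variable (hC : ∀ X : C, ∃ (N : C) (i : N ⟶ X), Mono i ∧ P N ∧
  ∀ ⦃Z : C⦄ (g : Z ⟶ X), P Z → ∃ l : Z ⟶ N, l ≫ i = g)

include hC in
-- Because `i` is monic, lifts through it are unique, so `i` is a universal arrow and becomes the
-- counit.
theorem exists_coreflector :
    ∃ (R : C ⥤ P.FullSubcategory) (adj : P.ι ⊣ R), ∀ X, Mono (adj.counit.app X) := by
  choose N i hi hN l hl using hC
  let e (Z : P.FullSubcategory) (X : C) : (Z.obj ⟶ X) ≃ (Z ⟶ ⟨N X, hN X⟩) :=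
    { toFun := fun g => ObjectProperty.homMk (l X g Z.property)
      invFun := fun f => f.hom ≫ i X
      left_inv := fun g => hl _ _ _
      right_inv := fun f => by
        ext
        have := hi X
        rw [← cancel_mono (i X)]
        exact hl _ _ _ }
  have he : ∀ X' X Y f g, e X' Y (P.ι.map f ≫ g) = f ≫ e X Y g := by
    intro X' X Y f g
    rw [← Equiv.eq_symm_apply]
    simp [e, hl]
  refine ⟨_, Adjunction.adjunctionOfEquivRight e he, fun X => ?_⟩
  simpa [e] using hi X

end Coreflective

/-! ### Coreflective subcategories of a topos -/

section Topos

variable {C : Type u} [Category.{v} C] {P : ObjectProperty C} {R : C ⥤ P.FullSubcategory}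
  (adj : P.ι ⊣ R)

include adj in
/-- A full coreflective subcategory that is closed under finite limits and subobjects has a subobject
classifier. -/
theorem hasSubobjectClassifier_fullSubcategory [HasPullbacks C] [HasSubobjectClassifier C]
    [PreservesLimitsOfShape WalkingCospan P.ι]
    (hM : ∀ ⦃X Y : C⦄ (i : X ⟶ Y), Mono i → P Y → P X) :
    HasSubobjectClassifier P.FullSubcategory := by
  obtain ⟨⟨c⟩⟩ := ‹HasSubobjectClassifier C›
  -- Transposition along `P.ι ⊣ R` turns this square into the classifying pullback in `C`.
  have hpb {U X : P.FullSubcategory} (m : U ⟶ X) [Mono m] (a : U ⟶ R.obj c.Ω₀) :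
      IsPullback m a (adj.homEquiv _ _ (c.χ (P.ι.map m))) (R.map c.truth) := by
    have ha : a = adj.homEquiv _ _ (c.χ₀ _) :=
      (adj.homEquiv _ _).symm.injective (Subsingleton.elim _ _)
    refine isPullback_of_exists_lift ?_ (fun T b d h => ?_) fun T l l' h _ => ?_
    · rw [ha, ← adj.homEquiv_naturality_right, ← adj.homEquiv_naturality_left,
        (c.isPullback (P.ι.map m)).w]
    · have h' := congr((adj.homEquiv _ _).symm $h)
      rw [adj.homEquiv_naturality_left_symm, adj.homEquiv_naturality_right_symm,
        Equiv.symm_apply_apply] at h'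
      refine ⟨P.fullyFaithfulι.preimage ((c.isPullback (P.ι.map m)).lift _ _ h'), ?_, ?_⟩
      · apply P.ι.map_injective
        simp
      · exact (adj.homEquiv _ _).symm.injective (Subsingleton.elim _ _)
    · rwa [cancel_mono] at h
  refine ⟨⟨{
    Ω₀ := R.obj c.Ω₀
    Ω := R.obj c.Ω
    truth := R.map c.truth
    mono_truth := have := adj.rightAdjoint_preservesLimits; inferInstance
    χ₀ := fun U => adj.homEquiv _ _ (c.χ₀ _)
    χ := fun m _ => adj.homEquiv _ _ (c.χ (P.ι.map m))
    isPullback := fun m _ => hpb m _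
    uniq := fun {U X} m _ χ₀' χ' h => ?_ }⟩⟩
  -- The transpose of `χ'` classifies some `V → X` in `C`, and `V` satisfies `P` as a subobject of
  -- `X`. Then `m` and `n'` are pullbacks of the same maps, so they are isomorphic subobjects with
  -- equal classifying maps.
  obtain ⟨V, n, _, hn⟩ := c.surjective_χ ((adj.homEquiv _ _).symm χ')
  rw [Equiv.symm_apply_eq] at hn
  let n' : (⟨V, hM n inferInstance X.property⟩ : P.FullSubcategory) ⟶ X := ObjectProperty.homMk n
  have : Mono n' := P.ι.mono_of_mono_map ‹Mono n›
  have hn' := hpb n' (adj.homEquiv _ _ (c.χ₀ _))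
  have hn'' : χ' = adj.homEquiv _ _ (c.χ (P.ι.map n')) := hn
  rw [hn''] at h ⊢
  let e := h.isoIsPullback _ _ hn'
  have he : P.ι.map e.inv ≫ P.ι.map m = P.ι.map n' := by
    rw [← P.ι.map_comp]
    simp [e]
  rw [classifier_χ_congr c (P.ι.mapIso e.symm) he]

include adj in
/-- A full coreflective subcategory that is closed under finite limits is cartesian closed. -/
theorem isLeftAdjoint_prod_fullSubcategory [HasBinaryProducts C]
    [HasBinaryProducts P.FullSubcategory] [PreservesLimitsOfShape (Discrete WalkingPair) P.ι]
    (h : ∀ X : C, (prod.functor.obj X).IsLeftAdjoint) (A : P.FullSubcategory) :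
    (prod.functor.obj A).IsLeftAdjoint := by
  have := h (P.ι.obj A)
  have := adj.isLeftAdjoint
  -- Since `P.ι` preserves products, this is `P.ι` followed by `A × -` in `C`, a composite of left
  -- adjoints; full faithfulness of `P.ι` then removes it from the hom-sets.
  have : (prod.functor.obj A ⋙ P.ι).IsLeftAdjoint :=
    Functor.isLeftAdjoint_of_iso (prodComparisonNatIso P.ι A).symm
  refine Functor.isLeftAdjoint_of_rightAdjointObjIsDefined_eq_top (top_unique fun B _ => ?_)
  have hB := (Functor.rightAdjointObjIsDefined_of_adjunction
    (Adjunction.ofIsLeftAdjoint (prod.functor.obj A ⋙ P.ι)) (P.ι.obj B))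
  obtain ⟨X, ⟨r⟩⟩ := hB
  exact Functor.RepresentableBy.isRepresentable (Y := X)
    { homEquiv := r.homEquiv.trans P.fullyFaithfulι.homEquiv.symm
      homEquiv_comp := fun f g => P.ι.map_injective (r.homEquiv_comp f g) }

/-- A full coreflective subcategory of a topos with monic counit that is closed under finite limits
and subobjects is a topos, and its inclusion is the inverse image of a hyperconnected geometric
morphism. -/
theorem isHyperconnectedInverseImage_ι [IsElementaryTopos C] (hT : P (⊤_ C))
    (hP : ∀ X Y, P X → P Y → P (X ⨯ Y)) (hM : ∀ ⦃X Y : C⦄ (i : X ⟶ Y), Mono i → P Y → P X)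
    (hC : ∀ X : C, ∃ (N : C) (i : N ⟶ X), Mono i ∧ P N ∧
      ∀ ⦃Z : C⦄ (g : Z ⟶ X), P Z → ∃ l : Z ⟶ N, l ≫ i = g) :
    ∃ _ : IsElementaryTopos P.FullSubcategory, IsHyperconnectedInverseImage P.ι := by
  have hJ := isClosedUnderLimitsOfShape_of_mono hT hP hM
  obtain ⟨R, adj, hR⟩ := exists_coreflector hC
  have : HasFiniteLimits P.FullSubcategory := ⟨fun J _ _ => inferInstance⟩
  have : PreservesFiniteLimits P.ι := ⟨fun J _ _ => inferInstance⟩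
  have hS := hasSubobjectClassifier_fullSubcategory adj hM
  have hE : IsElementaryTopos P.FullSubcategory :=
    { exponentiable := isLeftAdjoint_prod_fullSubcategory adj IsElementaryTopos.exponentiable }
  exact ⟨hE, ⟨R, P.ι, adj, inferInstance⟩, rfl, inferInstance, inferInstance, hR⟩

end Topos

/-! ### Non-singular maps -/

section NonSingular

variable {E : Type u} [Category.{v} E] [CartesianMonoidalCategory E] [BraidedCategory E]
  {M : E} [MeetSemilatticeObj M] {m : ∀ X : E, X ⟶ M}

theorem inf_comm_lift {T : E} (a b : T ⟶ M) : lift a b ≫ MonObj.mul = lift b a ≫ MonObj.mul := by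
  rw [← IsCommMonObj.mul_comm M, lift_braiding_hom_assoc, IsCommMonObj.mul_comm]

theorem inf_self_lift {T : E} (a : T ⟶ M) : lift a a ≫ MonObj.mul = a := by
  have := congr(a ≫ $(MeetSemilatticeObj.inf_idem (M := M)))
  rwa [comp_lift_assoc, Category.comp_id] at this

/-- Families of maps with the product property increase along arbitrary maps. -/
theorem le_comp_of_hasProductProperty (hm : HasProductProperty m) (hmono : MonosNonSingular m)
    {Z X : E} (g : Z ⟶ X) : lift (m Z) (g ≫ m X) ≫ MonObj.mul = m Z := by
  have : Mono (lift (𝟙 Z) g) := by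
    have : Mono (lift (𝟙 Z) g ≫ fst _ _) := by rw [lift_fst]; infer_instance
    exact mono_of_mono _ (fst _ _)
  conv_rhs => rw [hmono (lift (𝟙 Z) g) this, hm]
  simp

/-- Antisymmetry: the preceding inequality for `g`, and for `f` precomposed with `g`, squeezes `g ≫
m X` between `m Z` and `g ≫ f ≫ m Y = m Z`. -/
theorem isNonSingular_of_comp (hm : HasProductProperty m) (hmono : MonosNonSingular m)
    {Z X Y : E} (g : Z ⟶ X) (f : X ⟶ Y) (h : IsNonSingular m (g ≫ f)) : IsNonSingular m g := by
  have h₁ := le_comp_of_hasProductProperty hm hmono g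
  have h₂ := congr(g ≫ $(le_comp_of_hasProductProperty hm hmono f))
  rw [comp_lift_assoc, ← Category.assoc g f, ← h, inf_comm_lift, h₁] at h₂
  exact h₂

theorem isHyperconnectedInverseImage_nonSingular [IsElementaryTopos E]
    (hm : HasProductProperty m) (hmono : MonosNonSingular m) (Y : E) :
    ∃ (_ : IsElementaryTopos (Over Y)) (_ : IsElementaryTopos (NonSingularOver m Y)),
      IsHyperconnectedInverseImage (nonSingularInto m Y).ι := by
  have := isElementaryTopos_over Y
  refine ⟨this, isHyperconnectedInverseImage_ι ?_ ?_ ?_ ?_⟩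
  · let e : ⊤_ (Over Y) ≅ Over.mk (𝟙 Y) := terminalIsTerminal.uniqueUpToIso Over.mkIdTerminal
    have he : e.hom.left = (⊤_ (Over Y)).hom := by simpa using Over.w e.hom
    exact hmono _ (he ▸ inferInstance)
  · intro A W hA hW
    -- The fibre product is a subobject of `A × W`, where both factors of the meet restrict to the
    -- structure map followed by `m Y`.
    have h := hmono (overProdToTensor A W) inferInstance
    rw [IsNonSingular, hm, lift_map_assoc, show m A.left = _ from hA, show m W.left = _ from hW,
      Over.w_assoc, Over.w_assoc, inf_self_lift] at h
    exact h
  · intro X W i _ hW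
    have h := hmono i.left inferInstance
    rw [IsNonSingular, show m W.left = _ from hW, Over.w_assoc] at h
    exact h
  · intro X
    -- The largest subobject of `X` whose map to `Y` is non-singular.
    let i := equalizer.ι (m X.left) (X.hom ≫ m Y)
    refine ⟨Over.mk (i ≫ X.hom), Over.homMk i, Over.mono_of_mono_left _, ?_, fun Z g hZ => ?_⟩
    · have h := hmono i inferInstance
      exact h.trans ((equalizer.condition _ _).trans (Category.assoc _ _ _).symm)
    · have hg : IsNonSingular m g.left :=
        isNonSingular_of_comp hm hmono g.left X.hom (by rw [Over.w]; exact hZ)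
      refine ⟨Over.homMk (equalizer.lift g.left ?_) ?_, ?_⟩
      · rw [Over.w_assoc]
        exact hg.symm.trans hZ
      · simp [i]
      · ext
        simp [i]

end NonSingular

/-! ### The semilattice structure on a local state classifier -/

namespace LocalStateClassifier

variable {E : Type u} [Category.{v} E] (L : LocalStateClassifier E)

theorem monosNonSingular_leg : MonosNonSingular L.leg := fun X Y f hf =>
  (L.cocone.w (show (⟨X⟩ : WideSubcategory (MorphismProperty.monomorphisms E)) ⟶ ⟨Y⟩ from
    ⟨f, hf⟩)).symm

theorem comp_leg {X Y : E} (f : X ⟶ Y) [hf : Mono f] : f ≫ L.leg Y = L.leg X :=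
  (L.monosNonSingular_leg f hf).symm

theorem exists_desc {A : E} (h : ∀ X : E, X ⟶ A)
    (hh : ∀ ⦃X Y : E⦄ (f : X ⟶ Y) [Mono f], f ≫ h Y = h X) :
    ∃ d : L.obj ⟶ A, ∀ X, L.leg X ≫ d = h X :=
  ⟨L.isColimit.desc ⟨A, { app := fun X => h X.obj, naturality := fun _ _ f =>
    (@hh _ _ f.hom f.property).trans (Category.comp_id _).symm }⟩, fun X => L.isColimit.fac _ ⟨X⟩⟩

theorem hom_ext {A : E} {f g : L.obj ⟶ A} (h : ∀ X, L.leg X ≫ f = L.leg X ≫ g) : f = g :=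
  L.isColimit.hom_ext fun X => h X.obj

variable [CartesianMonoidalCategory E] [MonoidalClosed E]

/-- `W ⊗ -` is a left adjoint, so it preserves the colimit. -/
theorem whiskerLeft_hom_ext {W A : E} {f g : W ⊗ L.obj ⟶ A}
    (h : ∀ X, W ◁ L.leg X ≫ f = W ◁ L.leg X ≫ g) : f = g := by
  apply MonoidalClosed.curry_injective
  refine L.hom_ext fun X => ?_
  rw [← MonoidalClosed.curry_natural_left, h, MonoidalClosed.curry_natural_left]

theorem exists_whiskerLeft_desc {W A : E} (h : ∀ X : E, W ⊗ X ⟶ A)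
    (hh : ∀ ⦃X Y : E⦄ (f : X ⟶ Y) [Mono f], W ◁ f ≫ h Y = h X) :
    ∃ d : W ⊗ L.obj ⟶ A, ∀ X, W ◁ L.leg X ≫ d = h X := by
  obtain ⟨d, hd⟩ := L.exists_desc (fun X => MonoidalClosed.curry (h X)) (fun X Y f _ => by
    rw [← MonoidalClosed.curry_natural_left, hh])
  refine ⟨MonoidalClosed.uncurry d, fun X => ?_⟩
  rw [← MonoidalClosed.uncurry_natural_left, hd, MonoidalClosed.uncurry_curry]

variable [BraidedCategory E]

theorem tensor_hom_ext {A : E} {f g : L.obj ⊗ L.obj ⟶ A}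
    (h : ∀ X Y, (L.leg X ⊗ₘ L.leg Y) ≫ f = (L.leg X ⊗ₘ L.leg Y) ≫ g) : f = g := by
  refine L.whiskerLeft_hom_ext fun Y => ?_
  rw [← cancel_epi (β_ _ _).hom]
  refine L.whiskerLeft_hom_ext fun X => ?_
  simpa [MonoidalCategory.tensorHom_def] using congr((β_ Y X).hom ≫ $(h X Y))

theorem tensor_tensor_hom_ext {A : E} {f g : (L.obj ⊗ L.obj) ⊗ L.obj ⟶ A}
    (h : ∀ X Y Z, ((L.leg X ⊗ₘ L.leg Y) ⊗ₘ L.leg Z) ≫ f =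
      ((L.leg X ⊗ₘ L.leg Y) ⊗ₘ L.leg Z) ≫ g) : f = g := by
  refine L.whiskerLeft_hom_ext fun Z => ?_
  rw [← cancel_epi (β_ _ _).hom]
  apply MonoidalClosed.curry_injective
  refine L.tensor_hom_ext fun X Y => ?_
  rw [← MonoidalClosed.curry_natural_left, ← MonoidalClosed.curry_natural_left]
  have := congr((β_ Z (X ⊗ Y)).hom ≫ $(h X Y Z))
  rw [MonoidalCategory.tensorHom_def, Category.assoc, Category.assoc] at this
  rw [BraidedCategory.braiding_naturality_right_assoc,
    BraidedCategory.braiding_naturality_right_assoc, this]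

/-- Tensoring preserves monomorphisms, so the legs at `X ⊗ Y` form a cocone in each variable and
descend first in `Y`, then in `X`. -/
theorem exists_inf : ∃ d : L.obj ⊗ L.obj ⟶ L.obj,
    ∀ X Y, (L.leg X ⊗ₘ L.leg Y) ≫ d = L.leg (X ⊗ Y) := by
  have h₁ (X : E) : ∃ d : X ⊗ L.obj ⟶ L.obj, ∀ Y, X ◁ L.leg Y ≫ d = L.leg (X ⊗ Y) :=
    L.exists_whiskerLeft_desc _ fun Y Y' f _ => L.comp_leg (X ◁ f)
  choose d hd using h₁
  obtain ⟨e, he⟩ := L.exists_whiskerLeft_desc (W := L.obj) (fun X => (β_ _ _).hom ≫ d X)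
    fun X X' f _ => by
      rw [← cancel_epi (β_ _ _).hom]
      refine L.whiskerLeft_hom_ext fun Y => ?_
      have : Mono (f ▷ Y) := ⟨fun a b hab => by
        have h₁ := congr($hab ≫ fst _ _)
        have h₂ := congr($hab ≫ snd _ _)
        simp only [Category.assoc, whiskerRight_fst, whiskerRight_snd] at h₁ h₂
        ext
        · rw [← cancel_mono f]
          simpa using h₁
        · exact h₂⟩
      have h := L.comp_leg (f ▷ Y)
      rw [← hd, ← hd] at h
      simpa [whisker_exchange_assoc] using h
  refine ⟨(β_ _ _).hom ≫ e, fun X Y => ?_⟩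
  rw [tensorHom_def', Category.assoc]
  simp [he, hd]

/-- The meet semilattice structure on a local state classifier. -/
theorem exists_meetSemilatticeObj :
    ∃ _ : MeetSemilatticeObj L.obj, HasProductProperty L.leg := by
  obtain ⟨d, hd⟩ := L.exists_inf
  -- Each law is tested on legs, where it says that the legs are compatible with a structural
  -- isomorphism (or, for idempotence, the diagonal), which is monic.
  have h₁ : L.leg (𝟙_ E) ▷ L.obj ≫ d = (λ_ L.obj).hom := L.whiskerLeft_hom_ext fun X => by
    rw [← tensorHom_def'_assoc, hd, ← L.comp_leg (λ_ X).hom]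
    simp
  have hc : (β_ L.obj L.obj).hom ≫ d = d := L.tensor_hom_ext fun X Y => by
    rw [BraidedCategory.braiding_naturality_assoc, hd, hd, L.comp_leg]
  have h₂ : L.obj ◁ L.leg (𝟙_ E) ≫ d = (ρ_ L.obj).hom := by
    rw [← hc, BraidedCategory.braiding_naturality_right_assoc, h₁, braiding_leftUnitor]
  have ha : d ▷ L.obj ≫ d = (α_ L.obj L.obj L.obj).hom ≫ L.obj ◁ d ≫ d :=
    L.tensor_tensor_hom_ext fun X Y Z => by
      rw [associator_naturality_assoc, tensorHom_comp_whiskerRight_assoc,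
        tensorHom_comp_whiskerLeft_assoc, hd, hd, hd, hd, L.comp_leg]
  let i : MeetSemilatticeObj L.obj :=
    { one := L.leg (𝟙_ E)
      mul := d
      one_mul := h₁
      mul_one := h₂
      mul_assoc := ha
      mul_comm := hc
      inf_idem := L.hom_ext fun X => by
        have := L.comp_leg (lift (𝟙 X) (𝟙 X))
        rw [← hd, lift_map_assoc, Category.id_comp] at this
        rw [comp_lift_assoc, Category.comp_id, this] }
  exact ⟨i, fun X Y => (hd X Y).symm⟩

end LocalStateClassifier

theorem mainTheorem1 (E : Type u) [Category.{v} E] [IsElementaryTopos E]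
    [CartesianMonoidalCategory E] [BraidedCategory E] :
    (∀ (M : E) [MeetSemilatticeObj M] (m : ∀ X : E, X ⟶ M),
      HasProductProperty m → MonosNonSingular m →
        ∀ Y : E, ∃ (_ : IsElementaryTopos (Over Y)) (_ : IsElementaryTopos (NonSingularOver m Y)),
          IsHyperconnectedInverseImage (nonSingularInto m Y).ι) ∧
    (∀ L : LocalStateClassifier E,
      (∃ _ : MeetSemilatticeObj L.obj, HasProductProperty L.leg) ∧ MonosNonSingular L.leg ∧
        ∀ Y : E, ∃ (_ : IsElementaryTopos (Over Y))
            (_ : IsElementaryTopos (NonSingularOver L.leg Y)),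
          IsHyperconnectedInverseImage (nonSingularInto L.leg Y).ι) := by
  refine ⟨fun M _ m hm hmono => isHyperconnectedInverseImage_nonSingular hm hmono, fun L => ?_⟩
  let := monoidalClosedOfIsElementaryTopos E
  obtain ⟨i, hi⟩ := L.exists_meetSemilatticeObj
  exact ⟨⟨i, hi⟩, L.monosNonSingular_leg,
    isHyperconnectedInverseImage_nonSingular hi L.monosNonSingular_leg⟩
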